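/- **Lemma 1 (Secure communication probability).** Let $\lambda_e>0$, $P_t>0$, $\sigma_S>0$, $\alpha>2$, $\beta_e>0$, $r_g\ge 0$. Let the eavesdroppers form a homogeneous Poisson point process $\Phi_e=\{y_0,y_1,\dots\}\subset\mathbb{R}^2$ of density $\lambda_e$ (with measurably enumerated points), and let a transmitter of power $P_t$ be located at the origin $o$. Let the fading gains $g_{y_i}$ be independent exponential random variables with mean $1$ (Rayleigh fading), jointly independent of the locations $(y_i)$. Then almost surely there is a strongest eavesdropper, i.e. a point $$y^*\in\arg\max_{y\in\Phi_e}\, g_y\|y\|^{-\alpha},$$ and, for any choice of such a maximizer, the probability that its signal-to-noise ratio $\mathrm{SNR}_S=P_t\,g_{y^*}\|y^*\|^{-\alpha}/\sigma_S^2$ is at most $\beta_e$, conditioned on the number $\mathcal N(\mathcal B(o,r_g))$ of eavesdroppers in the guard zone (the ball of radius $r_g$ centered at $o$) being zero, is $$\mathbb{P}\!\left(\frac{P_t\,g_{y^*}\|y^*\|^{-\alpha}}{\sigma_S^2}\le\beta_e\;\Big|\;\mathcal N(\mathcal B(o,r_g))=0\right)=\exp\!\left(-\frac{2\pi\lambda_e}{\alpha}\left(\frac{P_t}{\sigma_S^2\beta_e}\right)^{2/\alpha}\Gamma\!\left(\frac2\alpha,\frac{r_g^{\alpha}\beta_e\sigma_S^2}{P_t}\right)\right),$$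 where $\Gamma(a,x)=\int_x^\infty t^{a-1}e^{-t}\,dt$ is the upper incomplete gamma function. -/

import Mathlib

open MeasureTheory ProbabilityTheory Set

/-- The Euclidean plane. -/
abbrev Plane : Type := EuclideanSpace ℝ (Fin 2)

/-- The number of points of a point set `S` in the region `B`. -/
noncomputable def pointCount (S : Set Plane) (B : Set Plane) : ℕ∞ := (S ∩ B).encard

/-- The random point set `Φ` in the plane is a homogeneous Poisson point process with density
`lam`: the numbers of points in bounded Borel sets are random variables, the number of points in
`B` is Poisson distributed with mean `lam * area B`, and the numbers of points in finitely many
pairwise disjoint sets are independent. -/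
structure IsPoissonPointProcess {Ω : Type*} [MeasurableSpace Ω] (P : Measure Ω)
    (Φ : Ω → Set Plane) (lam : ℝ) : Prop where
  measurable_count : ∀ B : Set Plane, MeasurableSet B → Bornology.IsBounded B →
    Measurable (fun ω => pointCount (Φ ω) B)
  poisson_count : ∀ B : Set Plane, MeasurableSet B → Bornology.IsBounded B → ∀ k : ℕ,
    P {ω | pointCount (Φ ω) B = k} = poissonMeasure (lam * volume.real B).toNNReal {k}
  indep_count : ∀ (n : ℕ) (B : Fin n → Set Plane), (∀ i, MeasurableSet (B i)) →
    (∀ i, Bornology.IsBounded (B i)) → Pairwise (fun i j => Disjoint (B i) (B j)) →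
    iIndepFun (fun i ω => pointCount (Φ ω) (B i)) P

/-- `y 0, y 1, …` is a measurable enumeration, almost surely without repetition, of the random
point set `Φ`. -/
structure IsEnumeration {Ω : Type*} [MeasurableSpace Ω] (P : Measure Ω)
    (Φ : Ω → Set Plane) (y : ℕ → Ω → Plane) : Prop where
  measurable : ∀ i, Measurable (y i)
  injective : ∀ᵐ ω ∂P, Function.Injective (fun i => y i ω)
  range_eq : ∀ᵐ ω ∂P, Set.range (fun i => y i ω) = Φ ω

/-- Independent Rayleigh fading: the power gain `g i` of the link to the point `y i` is
exponentially distributed with mean `1`, the gains are mutually independent, and they are jointly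
independent of the locations. -/
structure IsRayleighFading {Ω : Type*} [MeasurableSpace Ω] (P : Measure Ω)
    (y : ℕ → Ω → Plane) (g : ℕ → Ω → ℝ) : Prop where
  measurable : ∀ i, Measurable (g i)
  exp_law : ∀ i, P.map (g i) = expMeasure 1
  indep : iIndepFun g P
  indep_locations : IndepFun (fun ω i => y i ω) (fun ω i => g i ω) P

/-- The channel gain `g ‖y‖ ^ (-α)` from the origin to the location `y`, with fading gain `g` and
path-loss exponent `α`. -/
noncomputable def channelGain (α g : ℝ) (y : Plane) : ℝ := g * ‖y‖ ^ (-α)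

/-- The signal-to-noise ratio at the location `y` for transmit power `Pt` at the origin and noise
power `sigma ^ 2`. -/
noncomputable def snr (Pt sigma α g : ℝ) (y : Plane) : ℝ :=
  Pt * channelGain α g y / sigma ^ 2

/-- For the locations `y` and fading gains `g`, the index `i` maximizes the channel gain. -/
def IsStrongest (α : ℝ) (y : ℕ → Plane) (g : ℕ → ℝ) (i : ℕ) : Prop :=
  ∀ j, channelGain α (g j) (y j) ≤ channelGain α (g i) (y i)

/-- The upper incomplete gamma function. -/
noncomputable def upperIncompleteGamma (a x : ℝ) : ℝ :=
  ∫ t in Ioi x, t ^ (a - 1) * Real.exp (-t)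

/-! Put `c = βe * sigmaS ^ 2 / Pt`. Since the strongest point maximizes the gain, its SNR is at most
`βe` exactly when every pair satisfies `g j ≤ c * ‖y j‖ ^ α`. Together with an empty guard zone this
says that all pairs (location, fading gain) lie in one fixed set `G`.

Given the locations, the fading gains are independent, so that event has probability `∏ κ (y j)`,
where `κ z` is the exponential measure of the section of `G` at `z`. The generating functional
`lintegral_infProd` turns the mean of this product into `exp (-lam * ∫ (1 - κ))`; this is
`measure_forall_mem`. The integral is the area of the guard zone plus the integral of `exp (-c * ‖z‖
^ α)` outside it. Conditioning cancels the area, and polar coordinates turn the rest into the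
incomplete gamma function.

A maximizer exists because almost surely only finitely many gains exceed any given positive level
(`ae_finite_exceed`). -/

open scoped ENNReal Topology

/-! ### Infinite products over the points of a configuration -/

/-- The infinite product `∏ h (x j)` of factors at most one, as the infimum of its partial
products. -/
noncomputable def infProd (h : Plane → ℝ≥0∞) (x : ℕ → Plane) : ℝ≥0∞ :=
  ⨅ m : ℕ, ∏ j ∈ Finset.range m, h (x j)

theorem antitone_prod_range {a : ℕ → ℝ≥0∞} (ha : ∀ j, a j ≤ 1) :
    Antitone fun m => ∏ j ∈ Finset.range m, a j := by
  refine antitone_nat_of_succ_le fun m => ?_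
  rw [Finset.prod_range_succ]
  exact mul_le_of_le_one_right' (ha m)

theorem infProd_one (x : ℕ → Plane) : infProd (fun _ => 1) x = 1 := by
  simp [infProd]

theorem infProd_mul {h₁ h₂ : Plane → ℝ≥0∞} (hh₁ : ∀ z, h₁ z ≤ 1) (hh₂ : ∀ z, h₂ z ≤ 1)
    (x : ℕ → Plane) :
    infProd (fun z => h₁ z * h₂ z) x = infProd h₁ x * infProd h₂ x := by
  unfold infProd
  rw [ENNReal.iInf_mul_iInf ⟨0, by simp⟩ ⟨0, by simp⟩]
  · simp_rw [Finset.prod_mul_distrib]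
  · intro i j
    exact ⟨max i j, mul_le_mul' (antitone_prod_range (fun _ => hh₁ _) (le_max_left i j))
      (antitone_prod_range (fun _ => hh₂ _) (le_max_right i j))⟩

theorem infProd_prod {ι : Type*} (t : Finset ι) {h : ι → Plane → ℝ≥0∞} (hh : ∀ i z, h i z ≤ 1)
    (x : ℕ → Plane) :
    infProd (fun z => ∏ i ∈ t, h i z) x = ∏ i ∈ t, infProd (h i) x := by
  classical
  induction t using Finset.induction_on with
  | empty => simp [infProd_one]
  | insert a t ha ih =>
    simp_rw [Finset.prod_insert ha]
    rw [infProd_mul (hh a) (fun z => Finset.prod_le_one' fun i _ => hh i z), ih]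

theorem prod_iInf_of_antitone (t : Finset ℕ) {a : ℕ → ℕ → ℝ≥0∞} (ha : ∀ j, Antitone (a j))
    (ha1 : ∀ j n, a j n ≤ 1) : ∏ j ∈ t, ⨅ n, a j n = ⨅ n, ∏ j ∈ t, a j n := by
  classical
  induction t using Finset.induction_on with
  | empty => simp
  | insert b t hb ih =>
    simp_rw [Finset.prod_insert hb]
    rw [ih, ENNReal.iInf_mul_iInf]
    · exact ⟨0, ((ha1 b 0).trans_lt ENNReal.one_lt_top).ne⟩
    · exact ⟨0, ((Finset.prod_le_one' fun i _ => ha1 i 0).trans_lt ENNReal.one_lt_top).ne⟩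
    · intro i j
      exact ⟨max i j, mul_le_mul' (ha b (le_max_left i j))
        (Finset.prod_le_prod' fun k _ => ha k (le_max_right i j))⟩

/-- Two infima commute. This is what defining the product as an infimum buys: decreasing limits pass
through it with no convergence argument. -/
theorem infProd_iInf {h : ℕ → Plane → ℝ≥0∞} (ha : ∀ z, Antitone fun n => h n z)
    (h1 : ∀ n z, h n z ≤ 1) (x : ℕ → Plane) :
    infProd (fun z => ⨅ n, h n z) x = ⨅ n, infProd (h n) x := by
  unfold infProd
  rw [iInf_comm]
  exact iInf_congr fun m => prod_iInf_of_antitone (Finset.range m) (fun j => ha (x j))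
    fun j n => h1 n (x j)

theorem infProd_mono {h₁ h₂ : Plane → ℝ≥0∞} (hh : ∀ z, h₁ z ≤ h₂ z) (x : ℕ → Plane) :
    infProd h₁ x ≤ infProd h₂ x :=
  iInf_mono fun _ => Finset.prod_le_prod' fun _ _ => hh _

theorem measurable_infProd {h : Plane → ℝ≥0∞} (hh : Measurable h) : Measurable (infProd h) :=
  Measurable.iInf fun _ => Finset.measurable_prod _ fun j _ => hh.comp (measurable_pi_apply j)

/-- The power `s ^ n`, with the value `0` for infinite `n`. -/
noncomputable def enatPow (s : ℝ≥0∞) (n : ℕ∞) : ℝ≥0∞ := if n = ⊤ then 0 else s ^ n.toNat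

theorem pointCount_range {x : ℕ → Plane} (hx : Function.Injective x) (B : Set Plane) :
    pointCount (range x) B = {j | x j ∈ B}.encard := by
  rw [pointCount, inter_comm, ← image_preimage_eq_inter_range, hx.encard_image]
  rfl

/-- Partial products are constant beyond the last index with `x j ∈ B`. Finiteness is needed: for `s
= 1` and infinitely many points the left side is 1 and the right side 0. -/
theorem infProd_ite {x : ℕ → Plane} (hx : Function.Injective x) (B : Set Plane)
    [DecidablePred (· ∈ B)]
    (hB : pointCount (range x) B ≠ ⊤) {s : ℝ≥0∞} (hs : s ≤ 1) :
    infProd (fun z => if z ∈ B then s else 1) x = enatPow s (pointCount (range x) B) := by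
  have hcard := pointCount_range hx B
  have hfin : {j | x j ∈ B}.Finite := by
    rw [hcard] at hB; exact encard_ne_top_iff.1 hB
  have hpart : ∀ m, ∏ j ∈ Finset.range m, (if x j ∈ B then s else 1) =
      s ^ ((Finset.range m).filter fun j => x j ∈ B).card := fun m => by
    rw [Finset.prod_ite]; simp
  have hval : enatPow s (pointCount (range x) B) = s ^ hfin.toFinset.card := by
    rw [enatPow, if_neg hB, hcard, hfin.encard_eq_coe_toFinset_card, ENat.toNat_natCast]
  rw [hval]
  unfold infProd
  simp_rw [hpart]
  apply le_antisymm
  · obtain ⟨M, hM⟩ := hfin.bddAbove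
    refine iInf_le_of_le (M + 1) (le_of_eq ?_)
    congr 2
    ext j
    simp only [Finset.mem_filter, Finset.mem_range, Finite.mem_toFinset, mem_ofPred_eq,
      and_iff_right_iff_imp]
    exact fun h => Nat.lt_succ_of_le (hM h)
  · refine le_iInf fun m => pow_le_pow_right_of_le_one' hs (Finset.card_le_card fun j hj => ?_)
    simpa using (Finset.mem_filter.1 hj).2

/-! ### Generating functions of Poisson counts -/

namespace IsPoissonPointProcess

variable {Ω : Type*} [MeasurableSpace Ω] {P : Measure Ω} {Φ : Ω → Set Plane} {lam : ℝ}

/-- The exponential series sums the Poisson weights. The value 0 of `enatPow` at `⊤` restricts the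
sum to finite counts, so almost sure finiteness need not be known yet. -/
theorem lintegral_enatPow (hΦ : IsPoissonPointProcess P Φ lam) (hlam : 0 ≤ lam) {B : Set Plane}
    (hB : MeasurableSet B) (hb : Bornology.IsBounded B) {s : ℝ} (hs : 0 ≤ s) :
    ∫⁻ ω, enatPow (ENNReal.ofReal s) (pointCount (Φ ω) B) ∂P =
      ENNReal.ofReal (Real.exp (-(lam * ((1 - s) * volume.real B)))) := by
  have hm := hΦ.measurable_count B hB hb
  have hr : 0 ≤ lam * volume.real B := by positivity
  rw [← lintegral_map (f := enatPow (ENNReal.ofReal s)) .of_discrete hm, lintegral_countable',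
    ← Function.Injective.tsum_eq (g := ((↑) : ℕ → ℕ∞)) Nat.cast_injective]
  · have hterm : ∀ k : ℕ, enatPow (ENNReal.ofReal s) k *
        (P.map fun ω => pointCount (Φ ω) B) {(k : ℕ∞)} =
        ENNReal.ofReal (Real.exp (-(lam * volume.real B)) *
          ((lam * volume.real B * s) ^ k / (k.factorial : ℝ))) := fun k => by
      rw [Measure.map_apply hm (measurableSet_singleton _)]
      have := hΦ.poisson_count B hB hb k
      rw [show (fun ω => pointCount (Φ ω) B) ⁻¹' {(k : ℕ∞)} =
        {ω | pointCount (Φ ω) B = k} from rfl, this, poissonMeasure_singleton, enatPow,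
        if_neg (ENat.natCast_ne_top k), ENat.toNat_natCast, ← ENNReal.ofReal_pow hs,
        ← ENNReal.ofReal_mul (by positivity), Real.coe_toNNReal _ hr]
      congr 1
      ring
    simp_rw [hterm]
    have hsum := (NormedSpace.expSeries_div_hasSum_exp (lam * volume.real B * s)).mul_left
      (Real.exp (-(lam * volume.real B)))
    rw [← ENNReal.ofReal_tsum_of_nonneg (fun k => by positivity) hsum.summable, hsum.tsum_eq,
      ← Real.exp_eq_exp_ℝ, ← Real.exp_add]
    congr 2
    ring
  · intro n hn
    induction n using ENat.recTopCoe with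
    | top => simp [enatPow] at hn
    | coe k => exact ⟨k, rfl⟩

/-- At `s = 1`, `enatPow` is the indicator of a finite count, and the generating function equals 1.
-/
theorem ae_pointCount_ne_top [IsProbabilityMeasure P] (hΦ : IsPoissonPointProcess P Φ lam)
    (hlam : 0 ≤ lam) {B : Set Plane} (hB : MeasurableSet B) (hb : Bornology.IsBounded B) :
    ∀ᵐ ω ∂P, pointCount (Φ ω) B ≠ ⊤ := by
  have h := hΦ.lintegral_enatPow hlam hB hb zero_le_one
  have hm : MeasurableSet {ω | pointCount (Φ ω) B ≠ ⊤} :=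
    hΦ.measurable_count B hB hb (measurableSet_singleton ⊤).compl
  have h2 : ∫⁻ ω, enatPow (ENNReal.ofReal 1) (pointCount (Φ ω) B) ∂P =
      ∫⁻ ω, {ω | pointCount (Φ ω) B ≠ ⊤}.indicator 1 ω ∂P := by
    refine lintegral_congr fun ω => ?_
    by_cases hω : pointCount (Φ ω) B = ⊤ <;> simp [enatPow, hω]
  rw [h2, lintegral_indicator_one hm] at h
  rw [sub_self, zero_mul, mul_zero, neg_zero, Real.exp_zero, ENNReal.ofReal_one] at h
  exact (prob_compl_eq_zero_iff hm).2 h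

theorem iIndepFun_pointCount (hΦ : IsPoissonPointProcess P Φ lam) {ι : Type*} [Fintype ι]
    {B : ι → Set Plane} (hB : ∀ i, MeasurableSet (B i)) (hb : ∀ i, Bornology.IsBounded (B i))
    (hd : Pairwise fun i j => Disjoint (B i) (B j)) :
    iIndepFun (fun i ω => pointCount (Φ ω) (B i)) P := by
  have e := Fintype.equivFin ι
  have h := hΦ.indep_count _ (fun k => B (e.symm k)) (fun _ => hB _) (fun _ => hb _)
    (fun i j hij => hd (e.symm.injective.ne hij))
  simpa using h.precomp e.injective

open scoped Classical in
theorem lintegral_infProd_prod_ite [IsProbabilityMeasure P]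
    (hΦ : IsPoissonPointProcess P Φ lam) (hlam : 0 ≤ lam) {y : ℕ → Ω → Plane}
    (hy : IsEnumeration P Φ y) {ι : Type*} [Fintype ι] {B : ι → Set Plane}
    (hB : ∀ i, MeasurableSet (B i)) (hb : ∀ i, Bornology.IsBounded (B i))
    (hd : Pairwise fun i j => Disjoint (B i) (B j)) {s : ι → ℝ} (hs0 : ∀ i, 0 ≤ s i)
    (hs1 : ∀ i, s i ≤ 1) :
    ∫⁻ ω, infProd (fun z => ∏ i, if z ∈ B i then ENNReal.ofReal (s i) else 1)
        (fun j => y j ω) ∂P =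
      ENNReal.ofReal (Real.exp (-(lam * ∑ i, (1 - s i) * volume.real (B i)))) := by
  have hs : ∀ i, ENNReal.ofReal (s i) ≤ 1 := fun i => ENNReal.ofReal_le_one.2 (hs1 i)
  have hae : ∀ᵐ ω ∂P, infProd (fun z => ∏ i, if z ∈ B i then ENNReal.ofReal (s i) else 1)
      (fun j => y j ω) = ∏ i, enatPow (ENNReal.ofReal (s i)) (pointCount (Φ ω) (B i)) := by
    filter_upwards [hy.injective, hy.range_eq,
      ae_all_iff.2 fun i => hΦ.ae_pointCount_ne_top hlam (hB i) (hb i)] with ω hinj hr hN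
    rw [infProd_prod Finset.univ (h := fun i z => if z ∈ B i then ENNReal.ofReal (s i) else 1)]
    · refine Finset.prod_congr rfl fun i _ => ?_
      rw [← hr]
      refine infProd_ite hinj (B i) ?_ (hs i)
      rw [hr]
      exact hN i
    · intro i z
      split_ifs
      exacts [hs i, le_rfl]
  rw [lintegral_congr_ae hae]
  have hind := (hΦ.iIndepFun_pointCount hB hb hd).comp
    (fun i => enatPow (ENNReal.ofReal (s i))) (fun _ => .of_discrete)
  have hprod := lintegral_prod_eq_prod_lintegral_of_indepFun Finset.univ
    (fun i ω => enatPow (ENNReal.ofReal (s i)) (pointCount (Φ ω) (B i))) hind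
    (fun i => (Measurable.of_discrete (f := enatPow (ENNReal.ofReal (s i)))).comp
      (hΦ.measurable_count _ (hB i) (hb i)))
  rw [hprod]
  simp_rw [hΦ.lintegral_enatPow hlam (hB _) (hb _) (hs0 _)]
  rw [← ENNReal.ofReal_prod_of_nonneg (fun i _ => (Real.exp_pos _).le), ← Real.exp_sum,
    Finset.mul_sum, Finset.sum_neg_distrib]

end IsPoissonPointProcess

/-! ### The generating functional and independent fading -/

namespace IsPoissonPointProcess

variable {Ω : Type*} [MeasurableSpace Ω] {P : Measure Ω} {Φ : Ω → Set Plane} {lam : ℝ}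

open scoped Classical in
theorem lintegral_infProd_simpleFunc [IsProbabilityMeasure P]
    (hΦ : IsPoissonPointProcess P Φ lam) (hlam : 0 ≤ lam) {y : ℕ → Ω → Plane}
    (hy : IsEnumeration P Φ y) (φ : SimpleFunc Plane ℝ≥0∞) (hφ : ∀ z, φ z ≤ 1) {S : Set Plane}
    (hS : MeasurableSet S) (hSb : Bornology.IsBounded S) (hφS : ∀ z ∉ S, φ z = 0) :
    ∫⁻ ω, infProd (fun z => 1 - φ z) (fun j => y j ω) ∂P =
      ENNReal.ofReal (Real.exp (-(lam * (∫⁻ z, φ z).toReal))) := by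
  have hv : ∀ v : φ.range, (v : ℝ≥0∞) ≤ 1 := by
    rintro ⟨v, hv⟩
    obtain ⟨z, rfl⟩ := SimpleFunc.mem_range.1 hv
    exact hφ z
  have hvt : ∀ v : φ.range, (v : ℝ≥0∞) ≠ ⊤ := fun v => ((hv v).trans_lt ENNReal.one_lt_top).ne
  have hv' : ∀ v : φ.range, (v : ℝ≥0∞).toReal ≤ 1 := fun v =>
    ENNReal.toReal_le_of_le_ofReal zero_le_one (by simpa using hv v)
  have key := hΦ.lintegral_infProd_prod_ite hlam hy (ι := φ.range)
    -- The level set of 0 is unbounded. Cutting with `S` makes it admissible and costs nothing,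
    -- since its factor is 1.
    (B := fun v => φ ⁻¹' {(v : ℝ≥0∞)} ∩ S)
    (fun v => (φ.measurableSet_preimage _).inter hS) (fun v => hSb.subset inter_subset_right)
    (fun v w hvw => Set.disjoint_left.2 fun z hz hz' => hvw (Subtype.ext
      ((hz.1 : φ z = v).symm.trans hz'.1)))
    (s := fun v => 1 - (v : ℝ≥0∞).toReal) (fun v => sub_nonneg.2 (hv' v))
    (fun v => sub_le_self _ ENNReal.toReal_nonneg)
  have hprod : ∀ z, (∏ v : φ.range, @ite _ (z ∈ φ ⁻¹' {(v : ℝ≥0∞)} ∩ S)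
      (Classical.propDecidable _) (ENNReal.ofReal (1 - (v : ℝ≥0∞).toReal)) 1) = 1 - φ z := fun z => by
    by_cases hz : z ∈ S
    · rw [Finset.prod_eq_single (⟨φ z, SimpleFunc.mem_range_self φ z⟩ : φ.range)]
      · rw [if_pos ⟨rfl, hz⟩, ENNReal.ofReal_sub _ ENNReal.toReal_nonneg, ENNReal.ofReal_one,
          ENNReal.ofReal_toReal ((hφ z).trans_lt ENNReal.one_lt_top).ne]
      · intro w _ hw
        exact if_neg fun h => hw (Subtype.ext (h.1 : φ z = w).symm)
      · exact fun h => absurd (Finset.mem_univ _) h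
    · rw [hφS z hz, tsub_zero]
      exact Finset.prod_eq_one fun w _ => if_neg fun h => hz h.2
  simp_rw [hprod] at key
  rw [key, SimpleFunc.lintegral_eq_lintegral, SimpleFunc.lintegral, ENNReal.toReal_sum]
  · congr 4
    rw [← Finset.sum_coe_sort φ.range]
    refine Finset.sum_congr rfl fun v _ => ?_
    rw [sub_sub_cancel, ENNReal.toReal_mul, measureReal_def]
    by_cases h0 : (v : ℝ≥0∞) = 0
    · simp [h0]
    · congr 3
      refine inter_eq_left.2 fun z hz => by_contra fun hzS => h0 ?_
      rw [← (hz : φ z = v), hφS z hzS]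
  · intro v hvr
    by_cases h0 : v = 0
    · simp [h0]
    · refine ENNReal.mul_ne_top (hvt ⟨v, hvr⟩) (ne_top_of_le_ne_top hSb.measure_lt_top.ne
        (measure_mono fun z hz => by_contra fun hzS => h0 ?_))
      rw [← (hz : φ z = v), hφS z hzS]

/-- The probability generating functional of a homogeneous Poisson point process. -/
theorem lintegral_infProd [IsProbabilityMeasure P]
    (hΦ : IsPoissonPointProcess P Φ lam) (hlam : 0 ≤ lam) {y : ℕ → Ω → Plane}
    (hy : IsEnumeration P Φ y) {u : Plane → ℝ≥0∞} (hu : Measurable u) (hu1 : ∀ z, u z ≤ 1)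
    (hfin : ∫⁻ z, u z ≠ ⊤) :
    ∫⁻ ω, infProd (fun z => 1 - u z) (fun j => y j ω) ∂P =
      ENNReal.ofReal (Real.exp (-(lam * (∫⁻ z, u z).toReal))) := by
  classical
  -- Restricting to growing balls gives the bounded support required for simple functions and keeps
  -- the limit `u`.
  set φ : ℕ → SimpleFunc Plane ℝ≥0∞ := fun n =>
    (SimpleFunc.eapprox u n).restrict (Metric.ball 0 n) with hφdef
  have hφ : ∀ n z, φ n z = (Metric.ball 0 (n : ℝ)).indicator (SimpleFunc.eapprox u n) z :=
    fun n z => SimpleFunc.restrict_apply _ measurableSet_ball z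
  have hmono : ∀ z, Monotone fun n => φ n z := fun z m n hmn => by
    simp only [hφ]
    exact indicator_le_indicator_of_subset (Metric.ball_subset_ball (by exact_mod_cast hmn))
      (fun _ => zero_le) z |>.trans
      (indicator_le_indicator (SimpleFunc.monotone_eapprox u hmn z))
  have hsup : ∀ z, ⨆ n, φ n z = u z := fun z => by
    refine tendsto_nhds_unique (tendsto_atTop_iSup (hmono z))
      ((SimpleFunc.tendsto_eapprox hu z).congr' ?_)
    obtain ⟨N, hN⟩ := exists_nat_gt ‖z‖
    filter_upwards [Filter.eventually_ge_atTop N] with n hn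
    rw [hφ, indicator_of_mem]
    rw [mem_ball_zero_iff]
    exact hN.trans_le (by exact_mod_cast hn)
  have hle : ∀ n z, φ n z ≤ 1 := fun n z =>
    (le_iSup (fun n => φ n z) n).trans ((hsup z).le.trans (hu1 z))
  have hstep := fun n => hΦ.lintegral_infProd_simpleFunc hlam hy (φ n) (hle n)
    measurableSet_ball (Metric.isBounded_ball (x := 0) (r := (n : ℝ)))
    (fun z hz => by rw [hφ, indicator_of_notMem hz])
  have hanti : ∀ z, Antitone fun n => 1 - φ n z := fun z m n hmn =>
    tsub_le_tsub_left (hmono z hmn) 1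
  have hlim : ∀ ω, infProd (fun z => 1 - u z) (fun j => y j ω) =
      ⨅ n, infProd (fun z => 1 - φ n z) (fun j => y j ω) := fun ω => by
    rw [← infProd_iInf hanti fun _ _ => tsub_le_self]
    congr 1
    funext z
    rw [← hsup z, ENNReal.sub_iSup ENNReal.one_ne_top]
  have hmeas : ∀ n, Measurable fun ω => infProd (fun z => 1 - φ n z) (fun j => y j ω) :=
    fun n => (measurable_infProd (measurable_const.sub (φ n).measurable)).comp
      (measurable_pi_lambda _ hy.measurable)
  have hantiP : Antitone fun n ω => infProd (fun z => 1 - φ n z) (fun j => y j ω) :=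
    fun m n hmn ω => infProd_mono (fun z => hanti z hmn) _
  simp_rw [hlim]
  rw [lintegral_iInf hmeas hantiP]
  · refine tendsto_nhds_unique (tendsto_atTop_iInf fun m n hmn =>
      lintegral_mono (hantiP hmn)) ?_
    simp_rw [hstep]
    refine ENNReal.tendsto_ofReal ((Real.continuous_exp.tendsto _).comp
      (Filter.Tendsto.neg (Filter.Tendsto.const_mul lam
        ((ENNReal.tendsto_toReal hfin).comp ?_))))
    have := lintegral_tendsto_of_tendsto_of_monotone (μ := (volume : Measure Plane))
      (f := fun n z => φ n z) (F := u)
      (fun n => (φ n).measurable.aemeasurable) (ae_of_all _ hmono)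
      (ae_of_all _ fun z => (hsup z) ▸ tendsto_atTop_iSup (hmono z))
    exact this
  · rw [hstep]
    exact ENNReal.ofReal_ne_top

/-- For independent Rayleigh fading, the probability that all pairs of a location and its fading
gain belong to `G`. -/
theorem measure_forall_mem [IsProbabilityMeasure P]
    (hΦ : IsPoissonPointProcess P Φ lam) (hlam : 0 ≤ lam) {y : ℕ → Ω → Plane}
    (hy : IsEnumeration P Φ y) {g : ℕ → Ω → ℝ} (hg : IsRayleighFading P y g)
    {G : Set (Plane × ℝ)} (hG : MeasurableSet G)
    (hfin : ∫⁻ z, expMeasure 1 {t | (z, t) ∉ G} ≠ ⊤) :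
    P {ω | ∀ j, (y j ω, g j ω) ∈ G} = ENNReal.ofReal
      (Real.exp (-(lam * (∫⁻ z, expMeasure 1 {t | (z, t) ∉ G}).toReal))) := by
  have := isProbabilityMeasure_expMeasure one_pos
  set κ : Plane → ℝ≥0∞ := fun z => expMeasure 1 (Prod.mk z ⁻¹' G)
  have hκm : Measurable κ := measurable_measure_prodMk_left hG
  have hYm : Measurable fun ω j => y j ω := measurable_pi_lambda _ hy.measurable
  have hgm : Measurable fun ω j => g j ω := measurable_pi_lambda _ hg.measurable
  -- Fubini on the joint law: with the locations frozen, independence of the gains gives a product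
  -- of sections.
  have hpart : ∀ m, P {ω | ∀ j ∈ Finset.range m, (y j ω, g j ω) ∈ G} =
      ∫⁻ ω, ∏ j ∈ Finset.range m, κ (y j ω) ∂P := fun m => by
    set A : Set ((ℕ → Plane) × (ℕ → ℝ)) := {p | ∀ j ∈ Finset.range m, (p.1 j, p.2 j) ∈ G}
    have hA : MeasurableSet A := by
      refine MeasurableSet.congr (s := ⋂ j ∈ Finset.range m,
        (fun p : (ℕ → Plane) × (ℕ → ℝ) => (p.1 j, p.2 j)) ⁻¹' G) ?_ (by ext; simp [A])
      exact Finset.measurableSet_biInter _ fun j _ => measurableSet_preimage (by fun_prop) hG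
    have hlaw := (indepFun_iff_map_prod_eq_prod_map_map hYm.aemeasurable hgm.aemeasurable).1
      hg.indep_locations
    have hsec : ∀ x : ℕ → Plane, (P.map fun ω j => g j ω) (Prod.mk x ⁻¹' A) =
        ∏ j ∈ Finset.range m, κ (x j) := fun x => by
      rw [Measure.map_apply hgm (measurable_prodMk_left hA)]
      have h := hg.indep.measure_inter_preimage_eq_mul (Finset.range m)
        (sets := fun j => Prod.mk (x j) ⁻¹' G) (fun j _ => measurable_prodMk_left hG)
      convert h using 1
      · congr 1
        ext ω
        simp [A]
      · refine Finset.prod_congr rfl fun j _ => ?_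
        rw [← Measure.map_apply (hg.measurable j) (measurable_prodMk_left hG), hg.exp_law j]
    calc P {ω | ∀ j ∈ Finset.range m, (y j ω, g j ω) ∈ G}
        = (P.map fun ω => ((fun j => y j ω), (fun j => g j ω))) A :=
          (Measure.map_apply (hYm.prodMk hgm) hA).symm
      _ = ∫⁻ ω, ∏ j ∈ Finset.range m, κ (y j ω) ∂P := by
          rw [hlaw, Measure.prod_apply hA]
          simp_rw [hsec]
          rw [lintegral_map (f := fun x : ℕ → Plane => ∏ j ∈ Finset.range m, κ (x j))
            (Finset.measurable_prod _ fun j _ => hκm.comp (measurable_pi_apply j)) hYm]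
  have hκ1 : ∀ z, κ z ≤ 1 := fun z => prob_le_one
  have hsub : ∀ z, 1 - expMeasure 1 {t | (z, t) ∉ G} = κ z := fun z => by
    have h := prob_compl_eq_one_sub (μ := expMeasure 1) (measurable_prodMk_left (x := z) hG)
    rw [show {t | (z, t) ∉ G} = (Prod.mk z ⁻¹' G)ᶜ from rfl, h]
    exact ENNReal.sub_sub_cancel ENNReal.one_ne_top (hκ1 z)
  have hum : Measurable fun z => expMeasure 1 {t | (z, t) ∉ G} :=
    measurable_measure_prodMk_left hG.compl
  rw [← hΦ.lintegral_infProd hlam hy hum (fun z => prob_le_one) hfin]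
  simp_rw [hsub]
  unfold infProd
  rw [lintegral_iInf (f := fun m ω => ∏ j ∈ Finset.range m, κ (y j ω))
    (fun m => Finset.measurable_prod _ fun j _ => hκm.comp (hy.measurable j))
    (fun m n hmn ω => antitone_prod_range (fun j => hκ1 (y j ω)) hmn)]
  · simp_rw [← hpart]
    rw [← Antitone.measure_iInter]
    · congr 1
      ext ω
      simp only [mem_ofPred_eq, mem_iInter, Finset.mem_range]
      exact ⟨fun h _ j _ => h j, fun h j => h (j + 1) j j.lt_succ_self⟩
    · intro m n hmn ω hω j hj
      exact hω j (Finset.range_mono hmn hj)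
    · intro m
      refine MeasurableSet.nullMeasurableSet (MeasurableSet.congr (s := ⋂ j ∈ Finset.range m,
        (fun ω => (y j ω, g j ω)) ⁻¹' G) ?_ (by ext; simp))
      exact Finset.measurableSet_biInter _ fun j _ =>
        measurableSet_preimage ((hy.measurable j).prodMk (hg.measurable j)) hG
    · exact ⟨0, measure_ne_top _ _⟩
  · simp

end IsPoissonPointProcess

/-! ### Exponential tails and radial integrals -/

theorem expMeasure_one_Ioi {t : ℝ} (ht : 0 ≤ t) :
    expMeasure 1 {s | ¬ s ≤ t} = ENNReal.ofReal (Real.exp (-t)) := by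
  have := isProbabilityMeasure_expMeasure one_pos
  have h := cdf_expMeasure_eq one_pos t
  rw [if_pos ht, one_mul, cdf_eq_real] at h
  have h2 := prob_compl_eq_one_sub (μ := expMeasure 1) (measurableSet_Iic (a := t))
  rw [← ofReal_measureReal (s := Iic t), h, ← ENNReal.ofReal_one,
    ← ENNReal.ofReal_sub _ (by simpa using ht), sub_sub_cancel] at h2
  exact h2

theorem expMeasure_one_Iic_zero : expMeasure 1 (Iic 0) = 0 := by
  have := isProbabilityMeasure_expMeasure one_pos
  have h := cdf_expMeasure_eq one_pos 0
  rw [if_pos le_rfl, cdf_eq_real] at h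
  rw [← measureReal_eq_zero_iff, h]
  simp

/-- At `z = 0` with `α ≠ 0` both powers are 0 by convention and the equivalence fails;
`ae_forall_ne` discards that case. -/
theorem channelGain_le_iff {α g b : ℝ} {z : Plane} (hz : z ≠ 0) :
    channelGain α g z ≤ b ↔ g ≤ b * ‖z‖ ^ α := by
  have h : 0 < ‖z‖ ^ α := Real.rpow_pos_of_pos (norm_pos_iff.2 hz) _
  rw [channelGain, Real.rpow_neg (norm_nonneg z), ← div_eq_mul_inv, div_le_iff₀ h]

theorem integrable_exp_neg_mul_norm_rpow {α c : ℝ} (hα : 0 < α) (hc : 0 < c) :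
    Integrable fun z : Plane => Real.exp (-(c * ‖z‖ ^ α)) := by
  refine (integrable_fun_norm_addHaar (volume : Measure Plane)
    (f := fun r => Real.exp (-(c * r ^ α)))).2 ?_
  have h := integrableOn_rpow_mul_exp_neg_mul_rpow (p := α) (s := 1) (b := c) (by norm_num) hα hc
  simpa using h

theorem integral_mul_exp_neg_mul_rpow_Ioi {α c R : ℝ} (hα : 0 < α) (hc : 0 < c) (hR : 0 ≤ R) :
    ∫ r in Ioi R, r * Real.exp (-(c * r ^ α)) =
      α⁻¹ * c⁻¹ ^ (2 / α) * upperIncompleteGamma (2 / α) (c * R ^ α) := by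
  -- The substitution is `t = c * r ^ α`, done as a power change followed by scaling; the exponent
  -- `2 / α - 1` leaves exactly one factor `r`.
  have h1 := integral_comp_rpow_Ioi_of_pos' (E := ℝ)
    (g := fun t => (c * t) ^ (2 / α - 1) * Real.exp (-(c * t))) hα (Real.rpow_nonneg hR α)
  rw [integral_comp_mul_left_Ioi (fun s => s ^ (2 / α - 1) * Real.exp (-s)) _ hc,
    Real.rpow_rpow_inv hR hα.ne'] at h1
  have h2 : ∫ x in Ioi R, (α * x ^ (α - 1)) •
        ((c * x ^ α) ^ (2 / α - 1) * Real.exp (-(c * x ^ α))) =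
      (α * c ^ (2 / α - 1)) * ∫ r in Ioi R, r * Real.exp (-(c * r ^ α)) := by
    rw [← integral_const_mul]
    refine setIntegral_congr_fun measurableSet_Ioi fun x hx => ?_
    have hx0 : 0 < x := hR.trans_lt hx
    have hpow : x ^ (α - 1) * (c * x ^ α) ^ (2 / α - 1) = c ^ (2 / α - 1) * x := by
      rw [Real.mul_rpow hc.le (Real.rpow_nonneg hx0.le _), ← Real.rpow_mul hx0.le, mul_left_comm,
        ← Real.rpow_add hx0]
      congr 1
      rw [show α - 1 + α * (2 / α - 1) = 1 by field_simp; ring, Real.rpow_one]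
    simp only [smul_eq_mul]
    linear_combination α * Real.exp (-(c * x ^ α)) * hpow
  rw [h2] at h1
  have hca : c ^ (2 / α) * c⁻¹ ^ (2 / α) = 1 := by
    rw [← Real.mul_rpow hc.le (inv_nonneg.2 hc.le), mul_inv_cancel₀ hc.ne', Real.one_rpow]
  have hc1 : c ^ (2 / α - 1) * c = c ^ (2 / α) := by
    rw [Real.rpow_sub_one hc.ne', div_mul_cancel₀ _ hc.ne']
  rw [smul_eq_mul] at h1
  change _ = c⁻¹ * upperIncompleteGamma (2 / α) (c * R ^ α) at h1
  have hαi : α * α⁻¹ = 1 := mul_inv_cancel₀ hα.ne'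
  have hci : c * c⁻¹ = 1 := mul_inv_cancel₀ hc.ne'
  set I := ∫ r in Ioi R, r * Real.exp (-(c * r ^ α))
  set Γ := upperIncompleteGamma (2 / α) (c * R ^ α)
  have h3 : α * c ^ (2 / α) * I = Γ := by
    rw [← hc1]
    linear_combination c * h1 + Γ * hci
  rw [← h3]
  linear_combination -(c ^ (2 / α) * c⁻¹ ^ (2 / α) * I) * hαi - I * hca

theorem integral_compl_ball_exp_neg_mul_norm_rpow {α c R : ℝ} (hα : 0 < α) (hc : 0 < c)
    (hR : 0 ≤ R) :
    ∫ z in (Metric.ball (0 : Plane) R)ᶜ, Real.exp (-(c * ‖z‖ ^ α)) =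
      2 * Real.pi / α * c⁻¹ ^ (2 / α) * upperIncompleteGamma (2 / α) (c * R ^ α) := by
  have hind : ∀ z : Plane, (Metric.ball (0 : Plane) R)ᶜ.indicator
      (fun z => Real.exp (-(c * ‖z‖ ^ α))) z =
      (Ici R).indicator (fun r => Real.exp (-(c * r ^ α))) ‖z‖ := fun z => by
    simp [indicator]
  rw [← integral_indicator measurableSet_ball.compl]
  simp_rw [hind]
  rw [integral_fun_norm_addHaar]
  have hradial : ∫ r in Ioi (0 : ℝ), r ^ (Module.finrank ℝ Plane - 1) •
      (Ici R).indicator (fun r => Real.exp (-(c * r ^ α))) r =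
      ∫ r in Ioi R, r * Real.exp (-(c * r ^ α)) := by
    have h : ∀ r : ℝ, r ^ (Module.finrank ℝ Plane - 1) •
        (Ici R).indicator (fun r => Real.exp (-(c * r ^ α))) r =
        (Ici R).indicator (fun r => r * Real.exp (-(c * r ^ α))) r := fun r => by
      by_cases hr : R ≤ r <;> simp [indicator, hr]
    simp_rw [h]
    rw [setIntegral_indicator measurableSet_Ici]
    refine setIntegral_congr_set ?_
    -- For `R = 0`, `Ici R` is not contained in `Ioi 0`, so the endpoint is handled separately.
    rcases hR.eq_or_lt with rfl | hR'
    · rw [inter_eq_left.2 Ioi_subset_Ici_self]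
      exact Filter.EventuallyEq.rfl
    · have hsub : Ici R ⊆ Ioi 0 := fun x hx => hR'.trans_le hx
      rw [inter_eq_right.2 hsub]
      exact Ioi_ae_eq_Ici.symm
  rw [hradial, integral_mul_exp_neg_mul_rpow_Ioi hα hc hR, measureReal_def,
    EuclideanSpace.volume_ball_fin_two]
  simp [ENNReal.toReal_ofReal Real.pi_pos.le]
  ring

theorem lintegral_compl_ball_ne_top {α c : ℝ} (hα : 0 < α) (hc : 0 < c) (R : ℝ) :
    ∫⁻ z in (Metric.ball (0 : Plane) R)ᶜ, ENNReal.ofReal (Real.exp (-(c * ‖z‖ ^ α))) ≠ ⊤ :=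
  (integrable_exp_neg_mul_norm_rpow hα hc).integrableOn.lintegral_lt_top.ne

theorem toReal_lintegral_compl_ball {α c R : ℝ} (hα : 0 < α) (hc : 0 < c) (hR : 0 ≤ R) :
    (∫⁻ z in (Metric.ball (0 : Plane) R)ᶜ,
      ENNReal.ofReal (Real.exp (-(c * ‖z‖ ^ α)))).toReal =
      2 * Real.pi / α * c⁻¹ ^ (2 / α) * upperIncompleteGamma (2 / α) (c * R ^ α) := by
  rw [← integral_compl_ball_exp_neg_mul_norm_rpow hα hc hR, integral_eq_lintegral_of_nonneg_ae
    (ae_of_all _ fun _ => (Real.exp_pos _).le)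
    (integrable_exp_neg_mul_norm_rpow hα hc).integrableOn.aestronglyMeasurable]

theorem tendsto_lintegral_compl_ball {α c : ℝ} (hα : 0 < α) (hc : 0 < c) :
    Filter.Tendsto (fun n : ℕ => ∫⁻ z in (Metric.ball (0 : Plane) n)ᶜ,
      ENNReal.ofReal (Real.exp (-(c * ‖z‖ ^ α)))) Filter.atTop (𝓝 0) := by
  simp_rw [← lintegral_indicator measurableSet_ball.compl]
  rw [← lintegral_zero (α := Plane) (μ := volume)]
  refine tendsto_lintegral_of_dominated_convergence
    (fun z => ENNReal.ofReal (Real.exp (-(c * ‖z‖ ^ α))))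
    (fun n => Measurable.indicator (by fun_prop) measurableSet_ball.compl)
    (fun n => ae_of_all _ fun z => indicator_le_self _ _ z)
    (integrable_exp_neg_mul_norm_rpow hα hc).lintegral_lt_top.ne (ae_of_all _ fun z => ?_)
  obtain ⟨N, hN⟩ := exists_nat_gt ‖z‖
  refine tendsto_const_nhds.congr' ?_
  filter_upwards [Filter.eventually_ge_atTop N] with n hn
  refine (indicator_of_notMem ?_ _).symm
  rw [mem_compl_iff, not_not, mem_ball_zero_iff]
  exact hN.trans_le (by exact_mod_cast hn)

/-- A level below `a 0` is exceeded by a nonempty finite set of terms, whose maximum is global. -/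
theorem exists_forall_le_of_finite_setOf_lt {a : ℕ → ℝ} (h0 : 0 < a 0)
    (hfin : ∀ k : ℕ, {j | ¬ a j ≤ 1 / ((k : ℝ) + 1)}.Finite) : ∃ i, ∀ j, a j ≤ a i := by
  obtain ⟨k, hk⟩ := exists_nat_one_div_lt h0
  obtain ⟨i, hi, hmax⟩ := (hfin k).exists_maximalFor a _ ⟨0, not_le.2 hk⟩
  refine ⟨i, fun j => ?_⟩
  by_cases hj : a j ≤ 1 / ((k : ℝ) + 1)
  · exact hj.trans (not_le.1 hi).le
  · exact (le_total (a j) (a i)).elim id fun h => hmax hj h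

theorem measurableSet_good_outside (α c R : ℝ) :
    MeasurableSet {p : Plane × ℝ | R ≤ ‖p.1‖ ∧ p.2 ≤ c * ‖p.1‖ ^ α} := by
  measurability

theorem measurableSet_good_or_inside (α c R : ℝ) :
    MeasurableSet {p : Plane × ℝ | ‖p.1‖ < R ∨ p.2 ≤ c * ‖p.1‖ ^ α} := by
  measurability

/-! ### Void probabilities and existence of a strongest point -/

namespace IsPoissonPointProcess

variable {Ω : Type*} [MeasurableSpace Ω] {P : Measure Ω} {Φ : Ω → Set Plane} {lam : ℝ}

theorem measure_pointCount_eq_zero (hΦ : IsPoissonPointProcess P Φ lam) (hlam : 0 ≤ lam)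
    {B : Set Plane} (hB : MeasurableSet B) (hb : Bornology.IsBounded B) :
    P {ω | pointCount (Φ ω) B = 0} = ENNReal.ofReal (Real.exp (-(lam * volume.real B))) := by
  have h := hΦ.poisson_count B hB hb 0
  rw [poissonMeasure_singleton, Real.coe_toNNReal _ (by positivity)] at h
  simpa using h

theorem ae_forall_ne [IsProbabilityMeasure P] (hΦ : IsPoissonPointProcess P Φ lam)
    (hlam : 0 ≤ lam) {y : ℕ → Ω → Plane} (hy : IsEnumeration P Φ y) (z : Plane) :
    ∀ᵐ ω ∂P, ∀ j, y j ω ≠ z := by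
  have h := hΦ.measure_pointCount_eq_zero hlam (measurableSet_singleton z)
    Bornology.isBounded_singleton
  rw [measureReal_def, measure_singleton, ENNReal.toReal_zero, mul_zero, neg_zero, Real.exp_zero,
    ENNReal.ofReal_one] at h
  have hae : ∀ᵐ ω ∂P, pointCount (Φ ω) {z} = 0 :=
    (prob_compl_eq_zero_iff (hΦ.measurable_count _ (measurableSet_singleton z)
      Bornology.isBounded_singleton (measurableSet_singleton 0))).2 h
  filter_upwards [hae, hy.range_eq] with ω hω hr j hj
  rw [pointCount, encard_eq_zero] at hω
  exact hω.subset ⟨hr ▸ mem_range_self j, hj⟩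

variable [IsProbabilityMeasure P] {y : ℕ → Ω → Plane} {g : ℕ → Ω → ℝ} {α c : ℝ}

/-- The probability that no point lies in the ball of radius `R` and that all channel gains are at
most `c`. -/
theorem measure_forall_outside (hΦ : IsPoissonPointProcess P Φ lam) (hlam : 0 ≤ lam)
    (hy : IsEnumeration P Φ y) (hg : IsRayleighFading P y g) (hα : 0 < α) (hc : 0 < c) (R : ℝ) :
    P {ω | ∀ j, R ≤ ‖y j ω‖ ∧ g j ω ≤ c * ‖y j ω‖ ^ α} =
      ENNReal.ofReal (Real.exp (-(lam * (volume.real (Metric.ball (0 : Plane) R) +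
        (∫⁻ z in (Metric.ball (0 : Plane) R)ᶜ,
          ENNReal.ofReal (Real.exp (-(c * ‖z‖ ^ α)))).toReal)))) := by
  have := isProbabilityMeasure_expMeasure one_pos
  have hI : ∫⁻ z, expMeasure 1 {t | (z, t) ∉
        {p : Plane × ℝ | R ≤ ‖p.1‖ ∧ p.2 ≤ c * ‖p.1‖ ^ α}} =
      volume (Metric.ball (0 : Plane) R) + ∫⁻ z in (Metric.ball (0 : Plane) R)ᶜ,
        ENNReal.ofReal (Real.exp (-(c * ‖z‖ ^ α))) := by
    rw [← lintegral_add_compl _ (measurableSet_ball (x := (0 : Plane)) (ε := R))]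
    congr 1
    · rw [← setLIntegral_one]
      refine setLIntegral_congr_fun measurableSet_ball fun z hz => ?_
      rw [mem_ball_zero_iff] at hz
      simp [not_le.2 hz]
    · refine setLIntegral_congr_fun measurableSet_ball.compl fun z hz => ?_
      rw [mem_compl_iff, mem_ball_zero_iff, not_lt] at hz
      rw [← expMeasure_one_Ioi (by positivity : 0 ≤ c * ‖z‖ ^ α)]
      simp [hz]
  have hJ := lintegral_compl_ball_ne_top hα hc R
  have h := hΦ.measure_forall_mem hlam hy hg (measurableSet_good_outside α c R)
    (by rw [hI]; exact ENNReal.add_ne_top.2 ⟨measure_ball_lt_top.ne, hJ⟩)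
  rw [hI, ENNReal.toReal_add measure_ball_lt_top.ne hJ] at h
  exact h

/-- The probability that all channel gains of points outside the ball of radius `R` are at most
`c`. -/
theorem measure_forall_inside_or (hΦ : IsPoissonPointProcess P Φ lam) (hlam : 0 ≤ lam)
    (hy : IsEnumeration P Φ y) (hg : IsRayleighFading P y g) (hα : 0 < α) (hc : 0 < c) (R : ℝ) :
    P {ω | ∀ j, ‖y j ω‖ < R ∨ g j ω ≤ c * ‖y j ω‖ ^ α} =
      ENNReal.ofReal (Real.exp (-(lam * (∫⁻ z in (Metric.ball (0 : Plane) R)ᶜ,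
        ENNReal.ofReal (Real.exp (-(c * ‖z‖ ^ α)))).toReal))) := by
  have hI : ∫⁻ z, expMeasure 1 {t | (z, t) ∉
        {p : Plane × ℝ | ‖p.1‖ < R ∨ p.2 ≤ c * ‖p.1‖ ^ α}} =
      ∫⁻ z in (Metric.ball (0 : Plane) R)ᶜ,
        ENNReal.ofReal (Real.exp (-(c * ‖z‖ ^ α))) := by
    rw [← lintegral_indicator measurableSet_ball.compl]
    refine lintegral_congr fun z => ?_
    by_cases hz : ‖z‖ < R
    · simp [indicator, hz]
    · rw [indicator_of_mem (by simpa using hz),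
        ← expMeasure_one_Ioi (by positivity : 0 ≤ c * ‖z‖ ^ α)]
      simp [hz]
  have h := hΦ.measure_forall_mem hlam hy hg (measurableSet_good_or_inside α c R)
    (by rw [hI]; exact lintegral_compl_ball_ne_top hα hc R)
  rw [hI] at h
  exact h

/-- If no point outside the ball of radius `n` exceeds the level, all exceeding points lie in that
ball, which has finitely many points. The exceptional probability is at most `1 - exp (-lam * tail
n)`, and the tail of a convergent integral vanishes. -/
theorem ae_finite_exceed (hΦ : IsPoissonPointProcess P Φ lam) (hlam : 0 ≤ lam)
    (hy : IsEnumeration P Φ y) (hg : IsRayleighFading P y g) (hα : 0 < α) (hc : 0 < c) :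
    ∀ᵐ ω ∂P, {j | ¬ g j ω ≤ c * ‖y j ω‖ ^ α}.Finite := by
  have hsub : ∀ n : ℕ, ∀ᵐ ω ∂P, (∀ j, ‖y j ω‖ < n ∨ g j ω ≤ c * ‖y j ω‖ ^ α) →
      {j | ¬ g j ω ≤ c * ‖y j ω‖ ^ α}.Finite := fun n => by
    filter_upwards [hy.injective, hy.range_eq, hΦ.ae_pointCount_ne_top hlam
      (measurableSet_ball (x := (0 : Plane)) (ε := n)) Metric.isBounded_ball] with ω hinj hr hN hω
    rw [← hr, pointCount_range hinj, encard_ne_top_iff] at hN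
    exact hN.subset fun j hj => mem_ball_zero_iff.2 ((hω j).resolve_right hj)
  have hm : ∀ n : ℕ, MeasurableSet {ω | ∀ j, ‖y j ω‖ < n ∨ g j ω ≤ c * ‖y j ω‖ ^ α} :=
    fun n => by
      rw [ofPred_forall]
      exact MeasurableSet.iInter fun j => measurableSet_preimage
        ((hy.measurable j).prodMk (hg.measurable j)) (measurableSet_good_or_inside α c n)
  have hle : ∀ n : ℕ, P {ω | ¬ {j | ¬ g j ω ≤ c * ‖y j ω‖ ^ α}.Finite} ≤
      1 - ENNReal.ofReal (Real.exp (-(lam * (∫⁻ z in (Metric.ball (0 : Plane) n)ᶜ,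
        ENNReal.ofReal (Real.exp (-(c * ‖z‖ ^ α)))).toReal))) := fun n => by
    rw [← hΦ.measure_forall_inside_or hlam hy hg hα hc, ← prob_compl_eq_one_sub (hm n)]
    refine measure_mono_ae ?_
    filter_upwards [hsub n] with ω hω hinf hall
    exact hinf (hω hall)
  have hlim : Filter.Tendsto (fun n : ℕ => 1 - ENNReal.ofReal (Real.exp (-(lam *
      (∫⁻ z in (Metric.ball (0 : Plane) n)ᶜ,
        ENNReal.ofReal (Real.exp (-(c * ‖z‖ ^ α)))).toReal)))) Filter.atTop (𝓝 0) := by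
    have h := (ENNReal.tendsto_toReal ENNReal.zero_ne_top).comp
      (tendsto_lintegral_compl_ball hα hc)
    have h2 := ENNReal.Tendsto.sub (tendsto_const_nhds (x := (1 : ℝ≥0∞)))
      (ENNReal.tendsto_ofReal ((Real.continuous_exp.tendsto _).comp (h.const_mul lam).neg))
      (Or.inl ENNReal.one_ne_top)
    simpa using h2
  exact le_antisymm (ge_of_tendsto' hlim hle) zero_le

theorem ae_exists_isStrongest (hΦ : IsPoissonPointProcess P Φ lam) (hlam : 0 ≤ lam)
    (hy : IsEnumeration P Φ y) (hg : IsRayleighFading P y g) (hα : 0 < α) :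
    ∀ᵐ ω ∂P, ∃ i, IsStrongest α (fun j => y j ω) (fun j => g j ω) i := by
  have hpos : ∀ᵐ ω ∂P, 0 < g 0 ω := by
    have h : P (g 0 ⁻¹' Iic 0) = 0 := by
      rw [← Measure.map_apply (hg.measurable 0) measurableSet_Iic, hg.exp_law,
        expMeasure_one_Iic_zero]
    filter_upwards [measure_eq_zero_iff_ae_notMem.1 h] with ω hω
    simpa using hω
  filter_upwards [hpos, hΦ.ae_forall_ne hlam hy 0, ae_all_iff.2 fun k : ℕ =>
    hΦ.ae_finite_exceed hlam hy hg hα (c := 1 / ((k : ℝ) + 1)) (by positivity)]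
    with ω hg0 hne hfin
  refine exists_forall_le_of_finite_setOf_lt
    (a := fun j => channelGain α (g j ω) (y j ω)) ?_ fun k => ?_
  · exact mul_pos hg0 (Real.rpow_pos_of_pos (norm_pos_iff.2 (hne 0)) _)
  · simpa only [channelGain_le_iff (hne _)] using hfin k

end IsPoissonPointProcess

/-! ### From the strongest point to the conditional probability -/

theorem IsStrongest.snr_le_iff {Pt sigma α β : ℝ} (hPt : 0 < Pt) (hsigma : 0 < sigma)
    {x : ℕ → Plane} {h : ℕ → ℝ} {i : ℕ} (hi : IsStrongest α x h i) (hx : ∀ j, x j ≠ 0) :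
    snr Pt sigma α (h i) (x i) ≤ β ↔ ∀ j, h j ≤ β * sigma ^ 2 / Pt * ‖x j‖ ^ α := by
  have hiff : snr Pt sigma α (h i) (x i) ≤ β ↔
      channelGain α (h i) (x i) ≤ β * sigma ^ 2 / Pt := by
    rw [snr, div_le_iff₀ (by positivity), le_div_iff₀ hPt, mul_comm Pt]
  rw [hiff]
  constructor
  · exact fun hle j => (channelGain_le_iff (hx j)).1 ((hi j).trans hle)
  · exact fun hall => (channelGain_le_iff (hx i)).2 (hall i)

theorem lemma1 {Ω : Type*} [MeasurableSpace Ω] (P : Measure Ω) [IsProbabilityMeasure P]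
    (lam Pt sigmaS α βe rg : ℝ) (hlam : 0 < lam) (hPt : 0 < Pt) (hsigmaS : 0 < sigmaS)
    (hα : 2 < α) (hβe : 0 < βe) (hrg : 0 ≤ rg)
    (Φ : Ω → Set Plane) (hΦ : IsPoissonPointProcess P Φ lam)
    (y : ℕ → Ω → Plane) (hy : IsEnumeration P Φ y)
    (g : ℕ → Ω → ℝ) (hg : IsRayleighFading P y g) :
    (∀ᵐ ω ∂P, ∃ i, IsStrongest α (fun j => y j ω) (fun j => g j ω) i) ∧
    ∀ istar : Ω → ℕ,
      (∀ᵐ ω ∂P, IsStrongest α (fun j => y j ω) (fun j => g j ω) (istar ω)) →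
      (ProbabilityTheory.cond P {ω | pointCount (Φ ω) (Metric.ball 0 rg) = 0}).real
          {ω | snr Pt sigmaS α (g (istar ω) ω) (y (istar ω) ω) ≤ βe} =
        Real.exp (-(2 * Real.pi * lam / α) * (Pt / (sigmaS ^ 2 * βe)) ^ (2 / α) *
          upperIncompleteGamma (2 / α) (rg ^ α * βe * sigmaS ^ 2 / Pt)) := by
  have hα0 : 0 < α := two_pos.trans hα
  refine ⟨hΦ.ae_exists_isStrongest hlam.le hy hg hα0, fun istar hstar => ?_⟩
  have hc : 0 < βe * sigmaS ^ 2 / Pt := by positivity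
  have hm : MeasurableSet {ω | pointCount (Φ ω) (Metric.ball 0 rg) = 0} :=
    hΦ.measurable_count _ measurableSet_ball Metric.isBounded_ball (measurableSet_singleton 0)
  -- The choice `istar` may be non-measurable; almost surely the event does not depend on it, and
  -- `measure_congr` needs no measurability.
  have hset : P ({ω | pointCount (Φ ω) (Metric.ball 0 rg) = 0} ∩
      {ω | snr Pt sigmaS α (g (istar ω) ω) (y (istar ω) ω) ≤ βe}) =
      P {ω | ∀ j, rg ≤ ‖y j ω‖ ∧ g j ω ≤ βe * sigmaS ^ 2 / Pt * ‖y j ω‖ ^ α} := by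
    refine measure_congr ?_
    filter_upwards [hstar, hΦ.ae_forall_ne hlam.le hy 0, hy.range_eq] with ω hω hne hr
    refine propext ?_
    change pointCount (Φ ω) (Metric.ball 0 rg) = 0 ∧ _ ≤ βe ↔ ∀ j, _ ∧ _
    rw [hω.snr_le_iff hPt hsigmaS hne, forall_and, ← hr, pointCount, encard_eq_zero,
      ← disjoint_iff_inter_eq_empty, disjoint_left, forall_mem_range]
    simp only [mem_ball_zero_iff, not_lt]
  -- Dividing by the void probability removes the area of the ball from the exponent.
  rw [measureReal_def, cond_apply hm, hset,
    hΦ.measure_forall_outside hlam.le hy hg hα0 hc,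
    hΦ.measure_pointCount_eq_zero hlam.le measurableSet_ball Metric.isBounded_ball,
    ENNReal.toReal_mul, ENNReal.toReal_inv, ENNReal.toReal_ofReal (Real.exp_pos _).le,
    ENNReal.toReal_ofReal (Real.exp_pos _).le, ← Real.exp_neg, ← Real.exp_add,
    toReal_lintegral_compl_ball hα0 hc hrg]
  congr 1
  rw [show (βe * sigmaS ^ 2 / Pt)⁻¹ = Pt / (sigmaS ^ 2 * βe) by rw [inv_div, mul_comm βe],
    show βe * sigmaS ^ 2 / Pt * rg ^ α = rg ^ α * βe * sigmaS ^ 2 / Pt by ring]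
  ring
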